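/- Let $p\ge 3$ be an odd integer and let $q\in\mathbb C$ be a primitive $p$-th root of unity. For $z\in\mathbb C$ let $q^z$ be the principal value and put $[z]_q=\frac{q^{z}-q^{-z}}{q-q^{-1}}$. $U_q(sl_2)$ is the associative unital $\mathbb C$-algebra generated by $e,f,K,K^{-1}$ with relations $KK^{-1}=K^{-1}K=1$, $KeK^{-1}=q^2e$, $KfK^{-1}=q^{-2}f$, $ef-fe=\frac{K-K^{-1}}{q-q^{-1}}$. $U_q(\widehat{sl_2})$ is the associative unital $\mathbb C$-algebra generated by $e_i,f_i,K_i,K_i^{-1}$ ($i=0,1$) with relations $K_iK_i^{-1}=K_i^{-1}K_i=1$, $K_0K_1=K_1K_0$, $K_ie_iK_i^{-1}=q^2e_i$, $K_if_iK_i^{-1}=q^{-2}f_i$, $e_if_i-f_ie_i=\frac{K_i-K_i^{-1}}{q-q^{-1}}$ and, for $i\ne j$, $K_ie_jK_i^{-1}=q^{-2}e_j$, $K_if_jK_i^{-1}=q^{2}f_j$, $e_if_j=f_je_i$, $e_i^3e_j-[3]_qe_i^2e_je_i+[3]_qe_ie_je_i^2-e_je_i^3=0$, $f_i^3f_j-[3]_qf_i^2f_jf_i+[3]_qf_if_jf_i^2-f_jf_i^3=0$.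 Its comultiplication is $\Delta(e_i)=e_i\otimes K_i+1\otimes e_i$, $\Delta(f_i)=f_i\otimes1+K_i^{-1}\otimes f_i$, $\Delta(K_i^{\pm1})=K_i^{\pm1}\otimes K_i^{\pm1}$. For $x\in\mathbb C\setminus\{0\}$ the evaluation map $ev_x:U_q(\widehat{sl_2})\to U_q(sl_2)$ is the algebra homomorphism with $e_0\mapsto q^{-1}xf$, $e_1\mapsto e$, $f_0\mapsto qx^{-1}e$, $f_1\mapsto f$, $K_0^{\pm1}\mapsto K^{\mp1}$, $K_1^{\pm1}\mapsto K^{\pm1}$. For $\lambda\in\mathbb C$ let $V_\lambda$ be the $U_q(sl_2)$-module with basis $v_0,\dots,v_{p-1}$ (the normal basis) and $K^{\pm1}v_i=q^{\pm(\lambda-2i)}v_i$, $fv_i=[i+1]_qv_{i+1}$ for $i\neq p-1$, $fv_{p-1}=0$, $ev_i=[\lambda+1-i]_qv_{i-1}$ for $i\ne0$, $ev_0=0$. Let $\lambda_1,\lambda_2\in\mathbb C$ and $x,y\in\mathbb C\setminus\{0\}$, and let $V_{\lambda_1}(x)\otimes V_{\lambda_2}(y)$ be the space $V_{\lambda_1}\otimes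 V_{\lambda_2}$ on which $g\in U_q(\widehat{sl_2})$ acts by $(ev_x\otimes ev_y)\Delta(g)$; write $e$ for the action of $e_1$. Let $\{v_i\}$, $\{w_i\}$ be the normal bases of $V_{\lambda_1}$, $V_{\lambda_2}$, and let $\Phi_{p-1}=[p-1]_q\,v_{p-1}\otimes w_{p-1}$ be the lowest weight vector (annihilated by $f_1$ and $e_0$). Assume **Condition 1.** $[\lambda_j+1-i]_q\ne0$ for $i=0,\dots,p$, $j=1,2$, and $[\lambda_1+\lambda_2-2j+1-i]_q\neq0$ for $i=0,\dots,p$, $j=0,\dots,p-1$. **Theorem 5.2.** The family $f_0^{\,i}e^{\,j}\Phi_{p-1}$, $i,j=0,1,\dots,p-1$, is a basis of $V_{\lambda_1}\otimes V_{\lambda_2}$ if and only if **Condition 2.** $y/x\ne q^{\lambda_1+\lambda_2-2(l-1)}$ for $l=1,2,\dots,p-1$. -/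

import Mathlib

open scoped TensorProduct

namespace QAffine

noncomputable section

/-- The `q`-number `[z]_q = (q ^ z - q ^ (-z)) / (q - q⁻¹)` of a complex number `z`, where `q ^ z` is
the principal value of the complex power. -/
def qnum (q z : ℂ) : ℂ := (q ^ z - q ^ (-z)) / (q - q⁻¹)

/-- `q` is a root of unity, `p` is the smallest positive integer with `q ^ p = 1`, and `p` is odd.
The case `q = 1` is excluded, as the defining relations divide by `q - q⁻¹`. -/
structure IsOddRoot (q : ℂ) (p : ℕ) : Prop where
  prim : IsPrimitiveRoot q p
  odd : Odd p
  one_lt : 1 < p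

/-! ### The quantum algebra of `sl₂` -/

/-- Generators of `U_q(sl₂)`. -/
inductive SlGen
  | e | f | K | Kinv

/-- The generators in the free algebra. -/
abbrev SlGen.X (g : SlGen) : FreeAlgebra ℂ SlGen := FreeAlgebra.ι ℂ g

open SlGen in
/-- Defining relations of `U_q(sl₂)`. -/
inductive SlRel (q : ℂ) : FreeAlgebra ℂ SlGen → FreeAlgebra ℂ SlGen → Prop
  | K_Kinv : SlRel q (K.X * Kinv.X) 1
  | Kinv_K : SlRel q (Kinv.X * K.X) 1
  | K_e : SlRel q (K.X * e.X * Kinv.X) (q ^ 2 • e.X)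
  | K_f : SlRel q (K.X * f.X * Kinv.X) ((q ^ 2)⁻¹ • f.X)
  | e_f : SlRel q (e.X * f.X - f.X * e.X) ((q - q⁻¹)⁻¹ • (K.X - Kinv.X))

/-- The quantum algebra `U_q(sl₂)`. -/
abbrev UqSl (q : ℂ) : Type := RingQuot (SlRel q)

/-- The generators of `U_q(sl₂)`. -/
def UqSl.gen (q : ℂ) (g : SlGen) : UqSl q := RingQuot.mkAlgHom ℂ (SlRel q) g.X

/-! ### The quantum affine algebra of `sl₂` -/

/-- Generators of `U_q(ŝl₂)`; the index `i : Fin 2` is `0` or `1`. -/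
inductive AffGen
  | e (i : Fin 2) | f (i : Fin 2) | K (i : Fin 2) | Kinv (i : Fin 2)

/-- The generators in the free algebra. -/
abbrev AffGen.X (g : AffGen) : FreeAlgebra ℂ AffGen := FreeAlgebra.ι ℂ g

/-- The left-hand side `a³b - [3]_q a²ba + [3]_q aba² - ba³` of the quantum Serre relation. -/
def serre {A : Type*} [Ring A] [Algebra ℂ A] (q : ℂ) (a b : A) : A :=
  a ^ 3 * b - qnum q 3 • (a ^ 2 * b * a) + qnum q 3 • (a * b * a ^ 2) - b * a ^ 3

open AffGen in
/-- Defining relations of `U_q(ŝl₂)`. -/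
inductive AffRel (q : ℂ) : FreeAlgebra ℂ AffGen → FreeAlgebra ℂ AffGen → Prop
  | K_Kinv (i : Fin 2) : AffRel q ((K i).X * (Kinv i).X) 1
  | Kinv_K (i : Fin 2) : AffRel q ((Kinv i).X * (K i).X) 1
  | K_K : AffRel q ((K 0).X * (K 1).X) ((K 1).X * (K 0).X)
  | K_e (i : Fin 2) : AffRel q ((K i).X * (e i).X * (Kinv i).X) (q ^ 2 • (e i).X)
  | K_f (i : Fin 2) : AffRel q ((K i).X * (f i).X * (Kinv i).X) ((q ^ 2)⁻¹ • (f i).X)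
  | K_e' (i j : Fin 2) (h : i ≠ j) :
      AffRel q ((K i).X * (e j).X * (Kinv i).X) ((q ^ 2)⁻¹ • (e j).X)
  | K_f' (i j : Fin 2) (h : i ≠ j) :
      AffRel q ((K i).X * (f j).X * (Kinv i).X) (q ^ 2 • (f j).X)
  | e_f (i : Fin 2) : AffRel q ((e i).X * (f i).X - (f i).X * (e i).X)
      ((q - q⁻¹)⁻¹ • ((K i).X - (Kinv i).X))
  | e_f' (i j : Fin 2) (h : i ≠ j) : AffRel q ((e i).X * (f j).X - (f j).X * (e i).X) 0
  | serre_e (i j : Fin 2) (h : i ≠ j) : AffRel q (serre q (e i).X (e j).X) 0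
  | serre_f (i j : Fin 2) (h : i ≠ j) : AffRel q (serre q (f i).X (f j).X) 0

/-- The quantum affine algebra `U_q(ŝl₂)`. -/
abbrev UqAff (q : ℂ) : Type := RingQuot (AffRel q)

/-- The generators of `U_q(ŝl₂)`. -/
def UqAff.gen (q : ℂ) (g : AffGen) : UqAff q := RingQuot.mkAlgHom ℂ (AffRel q) g.X

/-! ### Elementary facts needed for the structure maps to be well defined -/

namespace IsOddRoot

variable {q : ℂ} {p : ℕ}

theorem ne_zero (h : IsOddRoot q p) : q ≠ 0 :=
  h.prim.ne_zero (by have := h.one_lt; omega)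

theorem sq_ne_one (h : IsOddRoot q p) : q ^ 2 ≠ 1 := by
  intro h2
  have h3 := (h.prim.pow_eq_one_iff_dvd 2).1 h2
  have h4 := Nat.le_of_dvd (by norm_num) h3
  have h5 := h.one_lt
  have h6 : p = 2 := by omega
  have h7 := h.odd
  rw [h6] at h7
  exact absurd h7 (by decide)

theorem sub_inv_ne_zero (h : IsOddRoot q p) : q - q⁻¹ ≠ 0 := by
  intro h1
  apply h.sq_ne_one
  have h0 := h.ne_zero
  field_simp at h1
  linear_combination h1

theorem qnum_three (h : IsOddRoot q p) : qnum q 3 = q ^ 2 + 1 + (q ^ 2)⁻¹ := by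
  have h0 := h.ne_zero
  have h1 := h.sub_inv_ne_zero
  have h2 : q ^ (3 : ℂ) = q ^ 3 := by exact_mod_cast Complex.cpow_natCast q 3
  rw [qnum, Complex.cpow_neg, h2, div_eq_iff h1]
  field_simp
  ring

end IsOddRoot

section algebra

variable {A : Type*} [Ring A] [Algebra ℂ A]

theorem mul_of_conj {k k' a : A} {c : ℂ} (hk : k' * k = 1) (h : k * a * k' = c • a) :
    k * a = c • (a * k) := by
  rw [← smul_mul_assoc, ← h, mul_assoc, hk, mul_one]

theorem inv_mul_of_conj {k k' a : A} {c : ℂ} (hc : c ≠ 0) (hk : k' * k = 1)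
    (h : k * a * k' = c • a) : k' * a = c⁻¹ • (a * k') := by
  have h1 : a * k' = c • (k' * a) := by
    rw [← mul_smul_comm, ← h, ← mul_assoc, ← mul_assoc, hk, one_mul]
  rw [h1, smul_smul, inv_mul_cancel₀ hc, one_smul]

theorem serre_smul (q c d : ℂ) (a b : A) : serre q (c • a) (d • b) = (c ^ 3 * d) • serre q a b := by
  simp only [serre, smul_pow, smul_mul_assoc, mul_smul_comm, smul_smul]
  module

theorem serre_add {q : ℂ} {p : ℕ} (h : IsOddRoot q p) {a b c d : A}
    (hab : a * b = q ^ 2 • (b * a)) (had : a * d = (q ^ 2)⁻¹ • (d * a))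
    (hcb : c * b = (q ^ 2)⁻¹ • (b * c)) (hac : serre q a c = 0) (hbd : serre q b d = 0) :
    serre q (a + b) (c + d) = 0 := by
  have h0 := h.ne_zero
  have hab' (z : A) : a * (b * z) = q ^ 2 • (b * (a * z)) := by
    rw [← mul_assoc, hab, smul_mul_assoc, mul_assoc]
  have had' (z : A) : a * (d * z) = (q ^ 2)⁻¹ • (d * (a * z)) := by
    rw [← mul_assoc, had, smul_mul_assoc, mul_assoc]
  have hcb' (z : A) : c * (b * z) = (q ^ 2)⁻¹ • (b * (c * z)) := by
    rw [← mul_assoc, hcb, smul_mul_assoc, mul_assoc]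
  rw [← add_zero (0 : A)]
  nth_rewrite 1 [← hac]
  rw [← hbd]
  simp only [serre, h.qnum_three, pow_succ, pow_zero, one_mul, mul_add, add_mul, mul_assoc, hab,
    had, hcb, hab', had', hcb', mul_smul_comm, smul_mul_assoc, smul_smul, smul_add]
  match_scalars <;> field_simp <;> ring

end algebra

section relations

variable {q : ℂ}

theorem UqSl.rel {a b : FreeAlgebra ℂ SlGen} (h : SlRel q a b) :
    RingQuot.mkAlgHom ℂ (SlRel q) a = RingQuot.mkAlgHom ℂ (SlRel q) b :=
  RingQuot.mkAlgHom_rel ℂ h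

theorem UqAff.rel {a b : FreeAlgebra ℂ AffGen} (h : AffRel q a b) :
    RingQuot.mkAlgHom ℂ (AffRel q) a = RingQuot.mkAlgHom ℂ (AffRel q) b :=
  RingQuot.mkAlgHom_rel ℂ h

theorem map_serre {A B : Type*} [Ring A] [Algebra ℂ A] [Ring B] [Algebra ℂ B] (φ : A →ₐ[ℂ] B)
    (a b : A) : φ (serre q a b) = serre q (φ a) (φ b) := by
  simp [serre]

end relations

section relations

variable {q : ℂ}

open UqSl in
theorem UqSl.K_Kinv : gen q .K * gen q .Kinv = 1 := by
  simpa [gen] using UqSl.rel (SlRel.K_Kinv (q := q))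

open UqSl in
theorem UqSl.Kinv_K : gen q .Kinv * gen q .K = 1 := by
  simpa [gen] using UqSl.rel (SlRel.Kinv_K (q := q))

open UqSl in
theorem UqSl.K_e : gen q .K * gen q .e * gen q .Kinv = q ^ 2 • gen q .e := by
  simpa [gen] using UqSl.rel (SlRel.K_e (q := q))

open UqSl in
theorem UqSl.K_f : gen q .K * gen q .f * gen q .Kinv = (q ^ 2)⁻¹ • gen q .f := by
  simpa [gen] using UqSl.rel (SlRel.K_f (q := q))

open UqSl in
theorem UqSl.e_f : gen q .e * gen q .f - gen q .f * gen q .e =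
    (q - q⁻¹)⁻¹ • (gen q .K - gen q .Kinv) := by
  simpa [gen] using UqSl.rel (SlRel.e_f (q := q))

open UqAff in
theorem UqAff.K_Kinv (i : Fin 2) : gen q (.K i) * gen q (.Kinv i) = 1 := by
  simpa [gen] using UqAff.rel (AffRel.K_Kinv (q := q) i)

open UqAff in
theorem UqAff.Kinv_K (i : Fin 2) : gen q (.Kinv i) * gen q (.K i) = 1 := by
  simpa [gen] using UqAff.rel (AffRel.Kinv_K (q := q) i)

open UqAff in
theorem UqAff.K_K : gen q (.K 0) * gen q (.K 1) = gen q (.K 1) * gen q (.K 0) := by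
  simpa [gen] using UqAff.rel (AffRel.K_K (q := q))

open UqAff in
theorem UqAff.K_e (i : Fin 2) :
    gen q (.K i) * gen q (.e i) * gen q (.Kinv i) = q ^ 2 • gen q (.e i) := by
  simpa [gen] using UqAff.rel (AffRel.K_e (q := q) i)

open UqAff in
theorem UqAff.K_f (i : Fin 2) :
    gen q (.K i) * gen q (.f i) * gen q (.Kinv i) = (q ^ 2)⁻¹ • gen q (.f i) := by
  simpa [gen] using UqAff.rel (AffRel.K_f (q := q) i)

open UqAff in
theorem UqAff.K_e' (i j : Fin 2) (h : i ≠ j) :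
    gen q (.K i) * gen q (.e j) * gen q (.Kinv i) = (q ^ 2)⁻¹ • gen q (.e j) := by
  simpa [gen] using UqAff.rel (AffRel.K_e' (q := q) i j h)

open UqAff in
theorem UqAff.K_f' (i j : Fin 2) (h : i ≠ j) :
    gen q (.K i) * gen q (.f j) * gen q (.Kinv i) = q ^ 2 • gen q (.f j) := by
  simpa [gen] using UqAff.rel (AffRel.K_f' (q := q) i j h)

open UqAff in
theorem UqAff.e_f (i : Fin 2) : gen q (.e i) * gen q (.f i) - gen q (.f i) * gen q (.e i) =
    (q - q⁻¹)⁻¹ • (gen q (.K i) - gen q (.Kinv i)) := by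
  simpa [gen] using UqAff.rel (AffRel.e_f (q := q) i)

open UqAff in
theorem UqAff.e_f' (i j : Fin 2) (h : i ≠ j) :
    gen q (.e i) * gen q (.f j) - gen q (.f j) * gen q (.e i) = 0 := by
  simpa [gen] using UqAff.rel (AffRel.e_f' (q := q) i j h)

open UqAff in
theorem UqAff.serre_e (i j : Fin 2) (h : i ≠ j) : serre q (gen q (.e i)) (gen q (.e j)) = 0 := by
  simpa [gen, map_serre] using UqAff.rel (AffRel.serre_e (q := q) i j h)

open UqAff in
theorem UqAff.serre_f (i j : Fin 2) (h : i ≠ j) : serre q (gen q (.f i)) (gen q (.f j)) = 0 := by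
  simpa [gen, map_serre] using UqAff.rel (AffRel.serre_f (q := q) i j h)

theorem UqSl.serre_aux {p : ℕ} (h : IsOddRoot q p) {A : Type*} [Ring A] [Algebra ℂ A]
    {a b k k' : A} {s : ℂ} (hab : a * b = b * a + s • (k - k'))
    (hkb : k * b = (q ^ 2)⁻¹ • (b * k)) (hkb' : k' * b = q ^ 2 • (b * k'))
    (hka : k * a = q ^ 2 • (a * k)) (hka' : k' * a = (q ^ 2)⁻¹ • (a * k')) :
    serre q a b = 0 ∧ serre q b a = 0 := by
  have h0 := h.ne_zero
  have hab2 (z : A) : a * (b * z) = b * (a * z) + s • (k * z - k' * z) := by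
    rw [← mul_assoc, hab, add_mul, smul_mul_assoc, mul_assoc, sub_mul]
  have hkb2 (z : A) : k * (b * z) = (q ^ 2)⁻¹ • (b * (k * z)) := by
    rw [← mul_assoc, hkb, smul_mul_assoc, mul_assoc]
  have hkb2' (z : A) : k' * (b * z) = q ^ 2 • (b * (k' * z)) := by
    rw [← mul_assoc, hkb', smul_mul_assoc, mul_assoc]
  have hka2 (z : A) : k * (a * z) = q ^ 2 • (a * (k * z)) := by
    rw [← mul_assoc, hka, smul_mul_assoc, mul_assoc]
  have hka2' (z : A) : k' * (a * z) = (q ^ 2)⁻¹ • (a * (k' * z)) := by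
    rw [← mul_assoc, hka', smul_mul_assoc, mul_assoc]
  constructor <;>
  · simp only [serre, h.qnum_three, pow_succ, pow_zero, one_mul, mul_add, add_mul, mul_sub, sub_mul,
      mul_assoc, hab, hkb, hkb', hka, hka', hab2, hkb2, hkb2', hka2, hka2', mul_smul_comm,
      smul_mul_assoc, smul_smul, smul_add, smul_sub]
    match_scalars <;> field_simp <;> ring

theorem UqSl.serre_e_f {p : ℕ} (h : IsOddRoot q p) :
    serre q (gen q .e) (gen q .f) = 0 ∧ serre q (gen q .f) (gen q .e) = 0 := by
  have h0 : q ^ 2 ≠ 0 := pow_ne_zero 2 h.ne_zero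
  refine UqSl.serre_aux h (k := gen q .K) (k' := gen q .Kinv) (s := (q - q⁻¹)⁻¹) ?_
    (mul_of_conj UqSl.Kinv_K UqSl.K_f) ?_ (mul_of_conj UqSl.Kinv_K UqSl.K_e)
    (inv_mul_of_conj h0 UqSl.Kinv_K UqSl.K_e)
  · rw [← UqSl.e_f]; abel
  · simpa using inv_mul_of_conj (inv_ne_zero h0) UqSl.Kinv_K UqSl.K_f

end relations

/-! ### The comultiplication of `U_q(ŝl₂)` -/

open UqAff in
/-- The comultiplication on generators. -/
def comulGen (q : ℂ) : AffGen → UqAff q ⊗[ℂ] UqAff q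
  | .e i => gen q (.e i) ⊗ₜ gen q (.K i) + 1 ⊗ₜ gen q (.e i)
  | .f i => gen q (.f i) ⊗ₜ 1 + gen q (.Kinv i) ⊗ₜ gen q (.f i)
  | .K i => gen q (.K i) ⊗ₜ gen q (.K i)
  | .Kinv i => gen q (.Kinv i) ⊗ₜ gen q (.Kinv i)

theorem serre_tmul_left {A : Type*} [Ring A] [Algebra ℂ A] (q : ℂ) (a b u v : A)
    (huv : u * v = v * u) :
    serre q (a ⊗ₜ[ℂ] u) (b ⊗ₜ[ℂ] v) = serre q a b ⊗ₜ[ℂ] (u ^ 3 * v) := by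
  have h2 (z : A) : v * (u * z) = u * (v * z) := by rw [← mul_assoc, ← huv, mul_assoc]
  simp only [serre, pow_succ, pow_zero, one_mul, Algebra.TensorProduct.tmul_mul_tmul, mul_assoc,
    huv.symm, h2, TensorProduct.add_tmul, TensorProduct.sub_tmul, TensorProduct.smul_tmul']

theorem serre_tmul_right {A : Type*} [Ring A] [Algebra ℂ A] (q : ℂ) (a b u v : A)
    (huv : u * v = v * u) :
    serre q (u ⊗ₜ[ℂ] a) (v ⊗ₜ[ℂ] b) = (u ^ 3 * v) ⊗ₜ[ℂ] serre q a b := by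
  have h2 (z : A) : v * (u * z) = u * (v * z) := by rw [← mul_assoc, ← huv, mul_assoc]
  simp only [serre, pow_succ, pow_zero, one_mul, Algebra.TensorProduct.tmul_mul_tmul, mul_assoc,
    huv.symm, h2, TensorProduct.tmul_add, TensorProduct.tmul_sub, TensorProduct.tmul_smul]

theorem comulGen_rel {q : ℂ} {p : ℕ} (h : IsOddRoot q p) {a b : FreeAlgebra ℂ AffGen}
    (hab : AffRel q a b) :
    FreeAlgebra.lift ℂ (comulGen q) a = FreeAlgebra.lift ℂ (comulGen q) b := by
  have h0 : q ^ 2 ≠ 0 := pow_ne_zero 2 h.ne_zero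
  have hKK (i j : Fin 2) : UqAff.gen q (.K i) * .gen q (.K j) = .gen q (.K j) * .gen q (.K i) := by
    fin_cases i <;> fin_cases j <;> simp [UqAff.K_K]
  have hKK' (i j : Fin 2) :
      UqAff.gen q (.K i) * .gen q (.Kinv j) = .gen q (.Kinv j) * .gen q (.K i) := by
    calc UqAff.gen q (.K i) * .gen q (.Kinv j)
        = .gen q (.Kinv j) * (.gen q (.K j) * .gen q (.K i)) * .gen q (.Kinv j) := by
          rw [← mul_assoc, UqAff.Kinv_K, one_mul]
      _ = .gen q (.Kinv j) * .gen q (.K i) := by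
          rw [← hKK, mul_assoc, mul_assoc, UqAff.K_Kinv, mul_one]
  have hK'K' (i j : Fin 2) :
      UqAff.gen q (.Kinv i) * .gen q (.Kinv j) = .gen q (.Kinv j) * .gen q (.Kinv i) := by
    calc UqAff.gen q (.Kinv i) * .gen q (.Kinv j)
        = .gen q (.Kinv i) * (.gen q (.Kinv j) * .gen q (.K i)) * .gen q (.Kinv i) := by
          rw [mul_assoc, mul_assoc, UqAff.K_Kinv, mul_one]
      _ = .gen q (.Kinv j) * .gen q (.Kinv i) := by
          rw [← hKK', ← mul_assoc, UqAff.Kinv_K, one_mul]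
  have hinv : ((q ^ 2)⁻¹)⁻¹ = q ^ 2 := inv_inv _
  have hi0 : (q ^ 2)⁻¹ ≠ 0 := inv_ne_zero h0
  have ke (i : Fin 2) := mul_of_conj (UqAff.Kinv_K (q := q) i) (UqAff.K_e i)
  have kf (i : Fin 2) := mul_of_conj (UqAff.Kinv_K (q := q) i) (UqAff.K_f i)
  have ke' (i j : Fin 2) (hij : i ≠ j) :=
    mul_of_conj (UqAff.Kinv_K (q := q) i) (UqAff.K_e' i j hij)
  have kf' (i j : Fin 2) (hij : i ≠ j) :=
    mul_of_conj (UqAff.Kinv_K (q := q) i) (UqAff.K_f' i j hij)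
  have le (i : Fin 2) := inv_mul_of_conj h0 (UqAff.Kinv_K (q := q) i) (UqAff.K_e i)
  have lf (i : Fin 2) := inv_mul_of_conj hi0 (UqAff.Kinv_K (q := q) i) (UqAff.K_f i)
  have le' (i j : Fin 2) (hij : i ≠ j) :=
    inv_mul_of_conj hi0 (UqAff.Kinv_K (q := q) i) (UqAff.K_e' i j hij)
  have lf' (i j : Fin 2) (hij : i ≠ j) :=
    inv_mul_of_conj h0 (UqAff.Kinv_K (q := q) i) (UqAff.K_f' i j hij)
  simp only [hinv] at lf le'
  have conjKe (i j : Fin 2) (c : ℂ) (hc : UqAff.gen q (.K i) * .gen q (.e j) * .gen q (.Kinv i) =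
      c • UqAff.gen q (.e j)) : comulGen q (.K i) * comulGen q (.e j) * comulGen q (.Kinv i) =
      c • comulGen q (.e j) := by
    have hk : UqAff.gen q (.K i) * .gen q (.K j) * .gen q (.Kinv i) = .gen q (.K j) := by
      rw [hKK, mul_assoc, UqAff.K_Kinv, mul_one]
    simp [comulGen, mul_add, add_mul, hc, hk, UqAff.K_Kinv, TensorProduct.smul_tmul']
  have conjKf (i j : Fin 2) (c : ℂ) (hc : UqAff.gen q (.K i) * .gen q (.f j) * .gen q (.Kinv i) =
      c • UqAff.gen q (.f j)) : comulGen q (.K i) * comulGen q (.f j) * comulGen q (.Kinv i) =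
      c • comulGen q (.f j) := by
    have hk : UqAff.gen q (.K i) * .gen q (.Kinv j) * .gen q (.Kinv i) = .gen q (.Kinv j) := by
      rw [hKK', mul_assoc, UqAff.K_Kinv, mul_one]
    simp [comulGen, mul_add, add_mul, hc, hk, UqAff.K_Kinv, TensorProduct.smul_tmul']
  cases hab with
  | K_Kinv i => simp [comulGen, UqAff.K_Kinv, Algebra.TensorProduct.one_def]
  | Kinv_K i => simp [comulGen, UqAff.Kinv_K, Algebra.TensorProduct.one_def]
  | K_K => simp [comulGen, UqAff.K_K]
  | K_e i => simpa using conjKe i i _ (UqAff.K_e i)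
  | K_f i => simpa using conjKf i i _ (UqAff.K_f i)
  | K_e' i j hij => simpa using conjKe i j _ (UqAff.K_e' i j hij)
  | K_f' i j hij => simpa using conjKf i j _ (UqAff.K_f' i j hij)
  | e_f i =>
    have key := UqAff.e_f (q := q) i
    rw [sub_eq_iff_eq_add'] at key
    simp only [map_sub, map_mul, map_smul, FreeAlgebra.lift_ι_apply, comulGen, mul_add, add_mul,
      Algebra.TensorProduct.tmul_mul_tmul, mul_one, one_mul, key, kf, le,
      TensorProduct.add_tmul, TensorProduct.tmul_add, TensorProduct.smul_tmul',
      TensorProduct.tmul_smul, TensorProduct.sub_tmul, TensorProduct.tmul_sub, smul_sub]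
    abel
  | e_f' i j hij =>
    have key := UqAff.e_f' (q := q) i j hij
    rw [sub_eq_zero] at key
    simp only [map_sub, map_mul, map_zero, FreeAlgebra.lift_ι_apply, comulGen, mul_add, add_mul,
      Algebra.TensorProduct.tmul_mul_tmul, mul_one, one_mul, key, kf' i j hij, le' j i hij.symm,
      TensorProduct.smul_tmul', TensorProduct.tmul_smul]
    abel
  | serre_e i j hij =>
    refine (map_serre (FreeAlgebra.lift ℂ (comulGen q)) _ _).trans (Eq.trans ?_ (map_zero _).symm)
    simp only [FreeAlgebra.lift_ι_apply, comulGen]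
    apply serre_add h
    · simp [ke, TensorProduct.tmul_smul]
    · simp [ke' i j hij, TensorProduct.tmul_smul]
    · simp [ke' j i hij.symm, TensorProduct.tmul_smul]
    · rw [serre_tmul_left _ _ _ _ _ (hKK i j), UqAff.serre_e i j hij, TensorProduct.zero_tmul]
    · rw [serre_tmul_right _ _ _ _ _ rfl, UqAff.serre_e i j hij, TensorProduct.tmul_zero]
  | serre_f i j hij =>
    refine (map_serre (FreeAlgebra.lift ℂ (comulGen q)) _ _).trans (Eq.trans ?_ (map_zero _).symm)
    simp only [FreeAlgebra.lift_ι_apply, comulGen]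
    rw [add_comm (UqAff.gen q (.f i) ⊗ₜ[ℂ] _), add_comm (UqAff.gen q (.f j) ⊗ₜ[ℂ] _)]
    apply serre_add h
    · simp [lf, TensorProduct.smul_tmul']
    · simp [lf' i j hij, TensorProduct.smul_tmul']
    · simp [lf' j i hij.symm, TensorProduct.smul_tmul']
    · rw [serre_tmul_right _ _ _ _ _ (hK'K' i j), UqAff.serre_f i j hij, TensorProduct.tmul_zero]
    · rw [serre_tmul_left _ _ _ _ _ rfl, UqAff.serre_f i j hij, TensorProduct.zero_tmul]

/-- The comultiplication of `U_q(ŝl₂)`: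
`Δ(eᵢ) = eᵢ ⊗ Kᵢ + 1 ⊗ eᵢ`, `Δ(fᵢ) = fᵢ ⊗ 1 + Kᵢ⁻¹ ⊗ fᵢ`, `Δ(Kᵢ) = Kᵢ ⊗ Kᵢ`. -/
def comul {q : ℂ} {p : ℕ} (h : IsOddRoot q p) : UqAff q →ₐ[ℂ] UqAff q ⊗[ℂ] UqAff q :=
  RingQuot.liftAlgHom ℂ ⟨FreeAlgebra.lift ℂ (comulGen q), fun _ _ => comulGen_rel h⟩

theorem comul_gen {q : ℂ} {p : ℕ} (h : IsOddRoot q p) (g : AffGen) :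
    comul h (UqAff.gen q g) = comulGen q g := by
  simp [comul, UqAff.gen]

/-! ### The evaluation map -/

open UqSl in
/-- The evaluation map on generators. -/
def evGen (q : ℂ) (x : ℂˣ) : AffGen → UqSl q
  | .e 0 => (q⁻¹ * (x : ℂ)) • gen q .f
  | .e 1 => gen q .e
  | .f 0 => (q * (x : ℂ)⁻¹) • gen q .e
  | .f 1 => gen q .f
  | .K 0 => gen q .Kinv
  | .K 1 => gen q .K
  | .Kinv 0 => gen q .K
  | .Kinv 1 => gen q .Kinv

theorem evGen_rel {q : ℂ} {p : ℕ} (h : IsOddRoot q p) (x : ℂˣ) {a b : FreeAlgebra ℂ AffGen}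
    (hab : AffRel q a b) :
    FreeAlgebra.lift ℂ (evGen q x) a = FreeAlgebra.lift ℂ (evGen q x) b := by
  have hq := h.ne_zero
  have h0 : q ^ 2 ≠ 0 := pow_ne_zero 2 hq
  have hx := x.ne_zero
  have ke := UqSl.K_e (q := q)
  have kf := UqSl.K_f (q := q)
  have le : UqSl.gen q .Kinv * .gen q .e * .gen q .K = (q ^ 2)⁻¹ • UqSl.gen q .e := by
    rw [inv_mul_of_conj h0 UqSl.Kinv_K ke, smul_mul_assoc, mul_assoc, UqSl.Kinv_K, mul_one]
  have lf : UqSl.gen q .Kinv * .gen q .f * .gen q .K = q ^ 2 • UqSl.gen q .f := by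
    rw [inv_mul_of_conj (inv_ne_zero h0) UqSl.Kinv_K kf, smul_mul_assoc, mul_assoc, UqSl.Kinv_K,
      mul_one, inv_inv]
  have key := UqSl.e_f (q := q)
  rw [sub_eq_iff_eq_add'] at key
  cases hab with
  | K_Kinv i => fin_cases i <;> simp [evGen, UqSl.K_Kinv, UqSl.Kinv_K]
  | Kinv_K i => fin_cases i <;> simp [evGen, UqSl.K_Kinv, UqSl.Kinv_K]
  | K_K => simp [evGen, UqSl.K_Kinv, UqSl.Kinv_K]
  | K_e i => fin_cases i <;> simp [evGen, ke, lf, smul_smul, mul_comm]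
  | K_f i => fin_cases i <;> simp [evGen, kf, le, smul_smul, mul_comm]
  | K_e' i j hij =>
    fin_cases i <;> fin_cases j <;> first | exact absurd rfl hij | skip
    all_goals simp [evGen, kf, le, smul_smul, mul_comm]
  | K_f' i j hij =>
    fin_cases i <;> fin_cases j <;> first | exact absurd rfl hij | skip
    all_goals simp [evGen, ke, lf, smul_smul, mul_comm]
  | e_f i =>
    fin_cases i
    · simp [evGen, key, smul_smul]
      match_scalars <;> (field_simp; try ring)
    · simp [evGen, key]
  | e_f' i j hij =>
    fin_cases i <;> fin_cases j <;> first | exact absurd rfl hij | skip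
    all_goals simp [evGen]
  | serre_e i j hij =>
    rw [map_serre, map_zero]
    fin_cases i <;> fin_cases j <;> first | exact absurd rfl hij | skip
    · have := serre_smul q (q⁻¹ * (x : ℂ)) 1 (UqSl.gen q .f) (UqSl.gen q .e)
      simpa [evGen, (UqSl.serre_e_f h).2] using this
    · have := serre_smul q 1 (q⁻¹ * (x : ℂ)) (UqSl.gen q .e) (UqSl.gen q .f)
      simpa [evGen, (UqSl.serre_e_f h).1] using this
  | serre_f i j hij =>
    rw [map_serre, map_zero]
    fin_cases i <;> fin_cases j <;> first | exact absurd rfl hij | skip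
    · have := serre_smul q (q * (x : ℂ)⁻¹) 1 (UqSl.gen q .e) (UqSl.gen q .f)
      simpa [evGen, (UqSl.serre_e_f h).1] using this
    · have := serre_smul q 1 (q * (x : ℂ)⁻¹) (UqSl.gen q .f) (UqSl.gen q .e)
      simpa [evGen, (UqSl.serre_e_f h).2] using this

/-- The evaluation map `ev_x : U_q(ŝl₂) → U_q(sl₂)` for a nonzero complex number `x`. -/
def ev {q : ℂ} {p : ℕ} (h : IsOddRoot q p) (x : ℂˣ) : UqAff q →ₐ[ℂ] UqSl q :=
  RingQuot.liftAlgHom ℂ ⟨FreeAlgebra.lift ℂ (evGen q x), fun _ _ => evGen_rel h x⟩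

theorem ev_gen {q : ℂ} {p : ℕ} (h : IsOddRoot q p) (x : ℂˣ) (g : AffGen) :
    ev h x (UqAff.gen q g) = evGen q x g := by
  simp [ev, UqAff.gen]

/-! ### The modules -/

/-- The underlying space of the `p`-dimensional module `V_lam`, with normal basis
`v₀, …, v_{p-1}` the standard basis. -/
abbrev V (p : ℕ) : Type := Fin p → ℂ

/-- The vector `vᵢ` of the normal basis. -/
def v {p : ℕ} (i : Fin p) : V p := Pi.single i 1

/-- The action of the generators of `U_q(sl₂)` on `V_lam`:
`K vᵢ = q ^ (lam - 2i) vᵢ`, `f vᵢ = [i + 1] vᵢ₊₁`, `e vᵢ = [lam + 1 - i] vᵢ₋₁`,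
with `f v_{p-1} = 0` and `e v₀ = 0`. -/
def repGen (q : ℂ) (p : ℕ) (lam : ℂ) : SlGen → Module.End ℂ (V p)
  | .K => (Pi.basisFun ℂ (Fin p)).constr ℂ fun i => q ^ (lam - 2 * (i : ℂ)) • v i
  | .Kinv => (Pi.basisFun ℂ (Fin p)).constr ℂ fun i => q ^ (-(lam - 2 * (i : ℂ))) • v i
  | .f => (Pi.basisFun ℂ (Fin p)).constr ℂ fun i =>
      if hi : (i : ℕ) + 1 < p then qnum q ((i : ℂ) + 1) • v ⟨i + 1, hi⟩ else 0
  | .e => (Pi.basisFun ℂ (Fin p)).constr ℂ fun i =>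
      if (i : ℕ) = 0 then 0
      else qnum q (lam + 1 - (i : ℂ)) • v ⟨i - 1, (Nat.sub_le _ _).trans_lt i.isLt⟩

section rep

variable {q : ℂ} {p : ℕ} {lam : ℂ}

theorem repGen_K_v (i : Fin p) :
    repGen q p lam .K (v i) = q ^ (lam - 2 * (i : ℂ)) • v i := by
  rw [v, ← Pi.basisFun_apply ℂ, repGen, Module.Basis.constr_basis]
  simp [v]

theorem repGen_Kinv_v (i : Fin p) :
    repGen q p lam .Kinv (v i) = q ^ (-(lam - 2 * (i : ℂ))) • v i := by
  rw [v, ← Pi.basisFun_apply ℂ, repGen, Module.Basis.constr_basis]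
  simp [v]

theorem repGen_f_v (i : Fin p) : repGen q p lam .f (v i) =
    if hi : (i : ℕ) + 1 < p then qnum q ((i : ℂ) + 1) • v ⟨i + 1, hi⟩ else 0 := by
  rw [v, ← Pi.basisFun_apply ℂ, repGen, Module.Basis.constr_basis]

theorem repGen_e_v (i : Fin p) : repGen q p lam .e (v i) =
    if (i : ℕ) = 0 then 0
    else qnum q (lam + 1 - (i : ℂ)) • v ⟨i - 1, (Nat.sub_le _ _).trans_lt i.isLt⟩ := by
  rw [v, ← Pi.basisFun_apply ℂ, repGen, Module.Basis.constr_basis]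

end rep

theorem repGen_rel {q : ℂ} {p : ℕ} (h : IsOddRoot q p) (lam : ℂ) {a b : FreeAlgebra ℂ SlGen}
    (hab : SlRel q a b) :
    FreeAlgebra.lift ℂ (repGen q p lam) a = FreeAlgebra.lift ℂ (repGen q p lam) b := by
  have hq := h.ne_zero
  have hs := h.sub_inv_ne_zero
  apply (Pi.basisFun ℂ (Fin p)).ext
  intro i
  rw [Pi.basisFun_apply]
  change _ = FreeAlgebra.lift ℂ (repGen q p lam) b (v i)
  change FreeAlgebra.lift ℂ (repGen q p lam) a (v i) = _
  have hcp (z : ℂ) (n : ℕ) : q ^ (z + n) = q ^ z * q ^ n := by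
    rw [Complex.cpow_add _ _ hq, Complex.cpow_natCast]
  have hcm (z : ℂ) (n : ℕ) : q ^ (z - n) = q ^ z * (q ^ n)⁻¹ := by
    rw [Complex.cpow_sub _ _ hq, Complex.cpow_natCast, div_eq_mul_inv]
  have hl : q ^ lam ≠ 0 := by simp [Complex.cpow_eq_zero_iff, hq]
  cases hab with
  | K_Kinv =>
    simp [repGen_K_v, repGen_Kinv_v, smul_smul, ← Complex.cpow_add _ _ hq]
  | Kinv_K =>
    simp [repGen_K_v, repGen_Kinv_v, smul_smul, ← Complex.cpow_add _ _ hq]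
  | K_e =>
    obtain ⟨i, hi⟩ := i
    rcases i with _ | i
    · simp [repGen_Kinv_v, repGen_e_v]
    · have e1 : q ^ (-(lam - 2 * ((i : ℂ) + 1))) = (q ^ lam)⁻¹ * q ^ (2 * i + 2) := by
        rw [← Complex.cpow_neg, ← hcp]; congr 1; push_cast; ring
      have e2 : q ^ (lam - 2 * (i : ℂ)) = q ^ lam * (q ^ (2 * i))⁻¹ := by
        rw [← hcm]; push_cast; rfl
      simp [-neg_sub, repGen_K_v, repGen_Kinv_v, repGen_e_v, smul_smul, e1, e2]
      match_scalars
      field_simp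
      ring
  | K_f =>
    obtain ⟨i, hi⟩ := i
    by_cases hi' : i + 1 < p
    · have e1 : q ^ (-(lam - 2 * (i : ℂ))) = (q ^ lam)⁻¹ * q ^ (2 * i) := by
        rw [← Complex.cpow_neg, ← hcp]; congr 1; push_cast; ring
      have e2 : q ^ (lam - 2 * ((i : ℂ) + 1)) = q ^ lam * (q ^ (2 * i + 2))⁻¹ := by
        rw [← hcm]; congr 1; push_cast; ring
      simp [-neg_sub, repGen_K_v, repGen_Kinv_v, repGen_f_v, hi', smul_smul, e1, e2]
      match_scalars
      field_simp
      ring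
    · simp [repGen_Kinv_v, repGen_f_v, hi']
  | e_f =>
    obtain ⟨i, hi⟩ := i
    have key : qnum q (i + 1) * qnum q (lam - i) - qnum q i * qnum q (lam + 1 - i) =
        (q - q⁻¹)⁻¹ * (q ^ (lam - 2 * (i : ℂ)) - q ^ (-(lam - 2 * (i : ℂ)))) := by
      have e0 : q ^ (i : ℂ) = q ^ i := Complex.cpow_natCast q i
      have e1 : q ^ ((i : ℂ) + 1) = q ^ i * q := by
        exact_mod_cast (Complex.cpow_natCast q (i + 1)).trans (pow_succ q i)
      have e2 : q ^ (lam - (i : ℂ)) = q ^ lam * (q ^ i)⁻¹ := hcm lam i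
      have e3 : q ^ (lam + 1 - (i : ℂ)) = q ^ lam * q * (q ^ i)⁻¹ := by
        rw [hcm, Complex.cpow_add _ _ hq, Complex.cpow_one]
      have e4 : q ^ (lam - 2 * (i : ℂ)) = q ^ lam * (q ^ (2 * i))⁻¹ := by
        rw [← hcm]; push_cast; rfl
      simp only [qnum, Complex.cpow_neg, e0, e1, e2, e3, e4]
      have hs' : q ^ 2 - 1 ≠ 0 := sub_ne_zero.2 h.sq_ne_one
      field_simp
      ring
    have hf0 : qnum q (0 : ℂ) = 0 := by simp [qnum]
    have hp : i + 1 = p → qnum q ((i : ℂ) + 1) = 0 := by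
      intro hip
      have : q ^ ((i : ℂ) + 1) = 1 := by
        have := Complex.cpow_natCast q (i + 1)
        rw [hip, h.prim.pow_eq_one, ← hip] at this
        exact_mod_cast this
      simp only [qnum, Complex.cpow_neg, this]
      simp
    have hef : repGen q p lam .e (repGen q p lam .f (v ⟨i, hi⟩)) =
        (qnum q (i + 1) * qnum q (lam - i)) • v ⟨i, hi⟩ := by
      by_cases hi' : i + 1 < p
      · simp [repGen_f_v, repGen_e_v, hi', smul_smul]
      · simp [repGen_f_v, hi', hp (by omega)]
    have hfe : repGen q p lam .f (repGen q p lam .e (v ⟨i, hi⟩)) =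
        (qnum q i * qnum q (lam + 1 - i)) • v ⟨i, hi⟩ := by
      rcases i with _ | i
      · simp [repGen_e_v, hf0]
      · simp [repGen_f_v, repGen_e_v, hi, smul_smul, mul_comm]
    simp only [map_sub, map_mul, map_smul, FreeAlgebra.lift_ι_apply, LinearMap.sub_apply,
      Module.End.mul_apply, LinearMap.smul_apply, hef, hfe, repGen_K_v, repGen_Kinv_v]
    rw [← sub_smul, ← sub_smul, smul_smul, key]

/-- The `U_q(sl₂)`-module `V_lam`. -/
def rep {q : ℂ} {p : ℕ} (h : IsOddRoot q p) (lam : ℂ) : UqSl q →ₐ[ℂ] Module.End ℂ (V p) :=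
  RingQuot.liftAlgHom ℂ ⟨FreeAlgebra.lift ℂ (repGen q p lam), fun _ _ => repGen_rel h lam⟩

theorem rep_gen {q : ℂ} {p : ℕ} (h : IsOddRoot q p) (lam : ℂ) (g : SlGen) :
    rep h lam (UqSl.gen q g) = repGen q p lam g := by
  simp [rep, UqSl.gen]

/-- The `U_q(ŝl₂)`-module `V_lam₁(x) ⊗ V_lam₂(y)`: the element `g` acts on the tensor product
through `(ev_x ⊗ ev_y) (Δ g)`. -/
def tensorRep {q : ℂ} {p : ℕ} (h : IsOddRoot q p) (lam₁ lam₂ : ℂ) (x y : ℂˣ) :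
    UqAff q →ₐ[ℂ] Module.End ℂ (V p ⊗[ℂ] V p) :=
  Module.endTensorEndAlgHom.comp
    ((Algebra.TensorProduct.map ((rep h lam₁).comp (ev h x)) ((rep h lam₂).comp (ev h y))).comp
      (comul h))

/-- `e₁` acts on the tensor product as `e` does through the coproduct of `U_q(sl₂)`. -/
theorem tensorRep_e_one {q : ℂ} {p : ℕ} (h : IsOddRoot q p) (lam₁ lam₂ : ℂ) (x y : ℂˣ)
    (a b : V p) : tensorRep h lam₁ lam₂ x y (UqAff.gen q (.e 1)) (a ⊗ₜ b) =
      repGen q p lam₁ .e a ⊗ₜ repGen q p lam₂ .K b + a ⊗ₜ repGen q p lam₂ .e b := by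
  simp [tensorRep, comul_gen, comulGen, ev_gen, evGen, rep_gen,
    Module.endTensorEndAlgHom_apply]

theorem tensorRep_f_zero {q : ℂ} {p : ℕ} (h : IsOddRoot q p) (lam₁ lam₂ : ℂ) (x y : ℂˣ)
    (a b : V p) : tensorRep h lam₁ lam₂ x y (UqAff.gen q (.f 0)) (a ⊗ₜ b) =
      (q * (x : ℂ)⁻¹) • (repGen q p lam₁ .e a ⊗ₜ b) +
        (q * (y : ℂ)⁻¹) • (repGen q p lam₁ .K a ⊗ₜ repGen q p lam₂ .e b) := by
  simp [tensorRep, comul_gen, comulGen, ev_gen, evGen, rep_gen, TensorProduct.smul_tmul',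
    Module.endTensorEndAlgHom_apply]

/-- The lowest weight vector `Φ_{p-1} = [p-1]_q v_{p-1} ⊗ w_{p-1}` of the tensor product, annihilated
by `f` and by `e₀`. -/
def lowestVector {q : ℂ} {p : ℕ} (h : IsOddRoot q p) : V p ⊗[ℂ] V p :=
  have hp : p - 1 < p := Nat.sub_lt (Nat.zero_lt_of_lt h.one_lt) one_pos
  qnum q ((p : ℂ) - 1) • (v ⟨p - 1, hp⟩ ⊗ₜ[ℂ] v ⟨p - 1, hp⟩)

/-- The genericity condition on the weights. -/
def Condition1 (q : ℂ) (p : ℕ) (lam₁ lam₂ : ℂ) : Prop :=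
  (∀ i : ℕ, i ≤ p → qnum q (lam₁ + 1 - i) ≠ 0 ∧ qnum q (lam₂ + 1 - i) ≠ 0) ∧
    ∀ i j : ℕ, i ≤ p → j ≤ p - 1 → qnum q (lam₁ + lam₂ - 2 * j + 1 - i) ≠ 0

/-- The condition `y / x ≠ q ^ (lam₁ + lam₂ - 2 (l - 1))` for `l = 1, …, p - 1`. -/
def Condition2 (q : ℂ) (p : ℕ) (lam₁ lam₂ : ℂ) (x y : ℂˣ) : Prop :=
  ∀ l : ℕ, 1 ≤ l → l ≤ p - 1 → (y : ℂ) / (x : ℂ) ≠ q ^ (lam₁ + lam₂ - 2 * ((l : ℂ) - 1))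

end

end QAffine

/-!
Put `t = y / x` and write `E₁ = e ⊗ 1`, `K₁ = K ⊗ 1`, `E₂ = 1 ⊗ e`, `K₂ = 1 ⊗ K` for the action of the
generators of `U_q(sl₂)` on the two factors. On the tensor product `e₁` acts as `E₁ K₂ + E₂`, and
`f₀` as a nonzero multiple of `t E₁ + K₁ E₂`. In each of these sums the two terms commute up to the
factor `q ^ (∓2)`, a primitive `p`-th root of unity, so their powers are given by the `q`-binomial
theorem (`add_pow_of_mul_eq_smul`). As the inner Gaussian binomial coefficients of row `p` vanish and
`e ^ p = 0` on each factor, both operators have `p`-th power zero. They commute, so the tensor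
product is a module over `ℂ[f₀, e₁] / (f₀ ^ p, e₁ ^ p)`. This algebra has dimension `p ^ 2`, and
every nonzero ideal of it contains `f₀ ^ (p - 1) e₁ ^ (p - 1)`. Hence the family is a basis if and
only if its last member `f₀ ^ (p - 1) e₁ ^ (p - 1) Φ` is nonzero (`linearIndependent_pow_mul_pow`).

That member is computed by multiplying the two `q`-binomial expansions. For degree reasons only the
terms with `E₁ ^ (p - 1) E₂ ^ (p - 1)` survive, and the Gaussian binomial coefficients of row `p - 1`
for `q ^ 2` and `q ^ (-2)` cancel in pairs (`gaussBinom_mul_gaussBinom_inv`,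
`raising_pow_mul_raising_pow`). What remains is a nonzero multiple of `v₀ ⊗ w₀`, times
`∑ t ^ (p - 1 - k) s ^ k = (t ^ p - s ^ p) / (t - s)` with `s = q ^ (lam₁ + lam₂ - 2 (p - 1))`
(`exists_tensorRep_pow_lowestVector`). This is zero exactly if `t = s ζ` for a `p`-th root of unity
`ζ ≠ 1` (`geom_sum_ne_zero_iff`); as `q ^ 2` is a primitive `p`-th root of unity, these are the
values which `Condition2` excludes.
-/

namespace QAffine

/-! ### Gaussian binomial coefficients and the `q`-binomial theorem -/

/-- The Gaussian binomial coefficient `(n choose k)_ω`, defined by its Pascal recursion. -/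
def gaussBinom (ω : ℂ) : ℕ → ℕ → ℂ
  | _, 0 => 1
  | 0, _ + 1 => 0
  | n + 1, k + 1 => gaussBinom ω n k + ω ^ (k + 1) * gaussBinom ω n (k + 1)

@[simp]
theorem gaussBinom_zero_right (ω : ℂ) (n : ℕ) : gaussBinom ω n 0 = 1 := by
  cases n <;> rfl

theorem gaussBinom_succ_succ (ω : ℂ) (n k : ℕ) :
    gaussBinom ω (n + 1) (k + 1) = gaussBinom ω n k + ω ^ (k + 1) * gaussBinom ω n (k + 1) := rfl

theorem gaussBinom_eq_zero_of_lt (ω : ℂ) {n k : ℕ} (h : n < k) : gaussBinom ω n k = 0 := by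
  induction n generalizing k with
  | zero => obtain ⟨k, rfl⟩ := Nat.exists_eq_succ_of_ne_zero h.ne'; rfl
  | succ n ih =>
    obtain ⟨k, rfl⟩ := Nat.exists_eq_succ_of_ne_zero (Nat.ne_zero_of_lt h)
    rw [gaussBinom_succ_succ, ih (by omega), ih (by omega), mul_zero, add_zero]

@[simp]
theorem gaussBinom_self (ω : ℂ) (n : ℕ) : gaussBinom ω n n = 1 := by
  induction n with
  | zero => rfl
  | succ n ih =>
    rw [gaussBinom_succ_succ, ih, gaussBinom_eq_zero_of_lt ω (Nat.lt_succ_self n), mul_zero,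
      add_zero]

/-- The ratio of neighbouring Gaussian binomial coefficients, with the denominator cleared. -/
theorem gaussBinom_succ_right_mul (ω : ℂ) {n k : ℕ} (hk : k ≤ n) :
    gaussBinom ω n (k + 1) * (ω ^ (k + 1) - 1) = gaussBinom ω n k * (ω ^ (n - k) - 1) := by
  induction n generalizing k with
  | zero =>
    obtain rfl : k = 0 := by omega
    simp [gaussBinom]
  | succ n ih =>
    rcases k with _ | k
    · have := ih (Nat.zero_le n)
      simp only [gaussBinom_succ_succ, gaussBinom_zero_right, zero_add, Nat.sub_zero] at this ⊢
      linear_combination ω ^ 1 * this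
    · rcases Nat.lt_or_ge n (k + 1) with hn | hn
      · obtain rfl : k = n := by omega
        simp [gaussBinom_eq_zero_of_lt]
      · obtain ⟨m, rfl⟩ := Nat.exists_eq_add_of_le hn
        have h1 := ih hn
        have h2 := ih (k := k) (by omega)
        rw [show k + 1 + m - (k + 1) = m by omega] at h1
        rw [show k + 1 + m - k = m + 1 by omega] at h2
        rw [show k + 1 + m + 1 - (k + 1) = m + 1 by omega, gaussBinom_succ_succ,
          gaussBinom_succ_succ]
        linear_combination ω ^ (k + 2) * h1 + h2

theorem pow_mul_pow_of_mul_eq_smul {A : Type*} [Ring A] [Algebra ℂ A] {c : ℂ} {a b : A}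
    (h : b * a = c • (a * b)) (m n : ℕ) :
    b ^ m * a ^ n = c ^ (m * n) • (a ^ n * b ^ m) := by
  have h1 (n : ℕ) : b * a ^ n = c ^ n • (a ^ n * b) := by
    induction n with
    | zero => simp
    | succ n ih =>
      rw [pow_succ, ← mul_assoc, ih, smul_mul_assoc, mul_assoc, h, mul_smul_comm, smul_smul,
        pow_succ, mul_assoc]
  induction m with
  | zero => simp
  | succ m ih =>
    rw [pow_succ, mul_assoc, h1, mul_smul_comm, ← mul_assoc, ih, smul_mul_assoc, smul_smul,
      mul_assoc, ← pow_add, Nat.succ_mul, add_comm]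

/-- The `q`-binomial theorem: if `b a = ω a b`, the powers of `a + b` expand with Gaussian binomial
coefficients. -/
theorem add_pow_of_mul_eq_smul {A : Type*} [Ring A] [Algebra ℂ A] {ω : ℂ} {a b : A}
    (h : b * a = ω • (a * b)) (n : ℕ) :
    (a + b) ^ n = ∑ k ∈ Finset.range (n + 1), gaussBinom ω n k • (a ^ k * b ^ (n - k)) := by
  have hba (k : ℕ) : b * a ^ k = ω ^ k • (a ^ k * b) := by
    simpa using pow_mul_pow_of_mul_eq_smul h 1 k
  induction n with
  | zero => simp
  | succ n ih =>
    have h1 : a * ∑ k ∈ Finset.range (n + 1), gaussBinom ω n k • (a ^ k * b ^ (n - k)) =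
        ∑ k ∈ Finset.range (n + 1), gaussBinom ω n k • (a ^ (k + 1) * b ^ (n - k)) := by
      simp only [Finset.mul_sum, mul_smul_comm, pow_succ', mul_assoc]
    have h2 : b * ∑ k ∈ Finset.range (n + 1), gaussBinom ω n k • (a ^ k * b ^ (n - k)) =
        ∑ k ∈ Finset.range (n + 1), (ω ^ k * gaussBinom ω n k) • (a ^ k * b ^ (n + 1 - k)) := by
      rw [Finset.mul_sum]
      refine Finset.sum_congr rfl fun k hk => ?_
      rw [Nat.sub_add_comm (Nat.lt_succ_iff.1 (Finset.mem_range.1 hk)), pow_succ', mul_smul_comm,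
        ← mul_assoc, hba, smul_mul_assoc, smul_smul, mul_assoc, mul_comm (ω ^ k)]
    rw [pow_succ', ih, add_mul, h1, h2, Finset.sum_range_succ' _ (n + 1)]
    simp only [gaussBinom_succ_succ, add_smul, Finset.sum_add_distrib, Nat.add_sub_add_right]
    rw [add_assoc]
    congr 1
    rw [Finset.sum_range_succ' _ n, Finset.sum_range_succ _ n,
      gaussBinom_eq_zero_of_lt ω (Nat.lt_succ_self n)]
    simp

section rootOfUnity

variable {ω : ℂ} {p : ℕ}

/-- If `ω` is a primitive `p`-th root of unity, the inner Gaussian binomial coefficients of row `p`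
vanish. -/
theorem gaussBinom_root (h : IsPrimitiveRoot ω p) {k : ℕ} (hk0 : 0 < k) (hk : k < p) :
    gaussBinom ω p k = 0 := by
  obtain ⟨k, rfl⟩ := Nat.exists_eq_succ_of_ne_zero hk0.ne'
  have hne : ω ^ (k + 1) - 1 ≠ 0 := sub_ne_zero.2 (h.pow_ne_one_of_pos_of_lt (by omega) hk)
  refine (mul_eq_zero.1 ?_).resolve_right hne
  rw [gaussBinom_succ_right_mul ω (by omega)]
  rcases Nat.eq_zero_or_pos k with rfl | hk1
  · simp [h.pow_eq_one]
  · rw [gaussBinom_root h hk1 (by omega), zero_mul]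

/-- Powers of the sum of two nilpotent elements that commute up to a root of unity. -/
theorem add_pow_eq_zero_of_mul_eq_smul {A : Type*} [Ring A] [Algebra ℂ A] {a b : A}
    (h : IsPrimitiveRoot ω p) (hba : b * a = ω • (a * b)) (ha : a ^ p = 0) (hb : b ^ p = 0) :
    (a + b) ^ p = 0 := by
  rw [add_pow_of_mul_eq_smul hba]
  refine Finset.sum_eq_zero fun k hk => ?_
  have hk' := Finset.mem_range.1 hk
  rcases Nat.eq_zero_or_pos k with rfl | h0
  · simp [hb]
  rcases Nat.lt_or_ge k p with hkp | hkp
  · rw [gaussBinom_root h h0 hkp, zero_smul]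
  · obtain rfl : k = p := by omega
    simp [ha]

/-- In row `p - 1` neighbouring Gaussian binomial coefficients differ by a factor `-ω ^ (k + 1)`,
by Pascal's recursion and the vanishing of row `p`. -/
theorem gaussBinom_pred_root (h : IsPrimitiveRoot ω p) {k : ℕ} (hk : k + 1 < p) :
    gaussBinom ω (p - 1) k = -(ω ^ (k + 1) * gaussBinom ω (p - 1) (k + 1)) := by
  have h1 := gaussBinom_root h k.succ_pos hk
  obtain ⟨n, rfl⟩ : ∃ n, p = n + 1 := ⟨p - 1, by omega⟩
  rw [gaussBinom_succ_succ] at h1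
  exact eq_neg_of_add_eq_zero_left h1

/-- Row `p - 1` for `ω⁻¹`, read from the left, is inverse to row `p - 1` for `ω`, read from the right:
from one entry to the next they change by inverse factors, and both begin with `1`. -/
theorem gaussBinom_mul_gaussBinom_inv (h : IsPrimitiveRoot ω p) {k l : ℕ} (hkl : k + l + 1 = p) :
    gaussBinom ω⁻¹ (p - 1) k * gaussBinom ω (p - 1) l = 1 := by
  induction k generalizing l with
  | zero =>
    obtain rfl : l = p - 1 := by omega
    simp
  | succ k ih =>
    have h1 := ih (l := l + 1) (by omega)
    have h2 := gaussBinom_pred_root h.inv (k := k) (by omega)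
    have h3 := gaussBinom_pred_root h (k := l) (by omega)
    have h4 : ω⁻¹ ^ (k + 1) = ω ^ (l + 1) := by
      rw [inv_pow]
      refine inv_eq_of_mul_eq_one_left ?_
      rw [← pow_add, show l + 1 + (k + 1) = p by omega, h.pow_eq_one]
    rw [h4] at h2
    rw [h3, ← h1, h2]
    ring

end rootOfUnity

/-! ### Powers of the raising operators -/

section raising

variable {A : Type*} [Ring A] [Algebra ℂ A]

variable {q : ℂ} {p : ℕ} {E₁ K₁ E₂ K₂ : A}

theorem IsOddRoot.prim_sq (h : IsOddRoot q p) : IsPrimitiveRoot (q ^ 2) p :=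
  h.prim.pow_of_coprime 2 (Nat.coprime_two_left.2 h.odd)

theorem E_mul_EK (h : IsOddRoot q p) (h₂ : K₂ * E₂ = q ^ 2 • (E₂ * K₂)) (hEE : Commute E₁ E₂) :
    E₂ * (E₁ * K₂) = (q ^ 2)⁻¹ • (E₁ * K₂ * E₂) := by
  rw [mul_assoc, h₂, mul_smul_comm, inv_smul_smul₀ (pow_ne_zero 2 h.ne_zero), ← mul_assoc,
    ← mul_assoc, hEE.eq]

theorem KE_mul_smul_E (h₁ : K₁ * E₁ = q ^ 2 • (E₁ * K₁)) (hEE : Commute E₁ E₂) (t : ℂ) :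
    K₁ * E₂ * (t • E₁) = q ^ 2 • (t • E₁ * (K₁ * E₂)) := by
  rw [mul_smul_comm, mul_assoc, ← hEE.eq, ← mul_assoc, h₁, smul_mul_assoc, smul_mul_assoc,
    smul_comm, mul_assoc]

theorem EK_add_E_pow (h : IsOddRoot q p) (h₂ : K₂ * E₂ = q ^ 2 • (E₂ * K₂))
    (hEE : Commute E₁ E₂) (hEK : Commute E₁ K₂) (hE₁ : E₁ ^ p = 0) (hE₂ : E₂ ^ p = 0) :
    (E₁ * K₂ + E₂) ^ p = 0 :=
  add_pow_eq_zero_of_mul_eq_smul h.prim_sq.inv (E_mul_EK h h₂ hEE)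
    (by rw [hEK.mul_pow, hE₁, zero_mul]) hE₂

theorem E_add_KE_pow (h : IsOddRoot q p) (h₁ : K₁ * E₁ = q ^ 2 • (E₁ * K₁))
    (hEE : Commute E₁ E₂) (hKE : Commute K₁ E₂) (hE₁ : E₁ ^ p = 0) (hE₂ : E₂ ^ p = 0) (t : ℂ) :
    (t • E₁ + K₁ * E₂) ^ p = 0 :=
  add_pow_eq_zero_of_mul_eq_smul h.prim_sq (KE_mul_smul_E h₁ hEE t)
    (by rw [smul_pow, hE₁, smul_zero]) (by rw [hKE.mul_pow, hE₂, mul_zero])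

/-- The product of the top powers of the two raising operators. Of the double sum over the two
`q`-binomial expansions only the terms of bidegree `(p - 1, p - 1)` in `E₁`, `E₂` survive, and there
the Gaussian binomial coefficients cancel. -/
theorem raising_pow_mul_raising_pow (h : IsOddRoot q p) (h₁ : K₁ * E₁ = q ^ 2 • (E₁ * K₁))
    (h₂ : K₂ * E₂ = q ^ 2 • (E₂ * K₂)) (hEE : Commute E₁ E₂) (hEK : Commute E₁ K₂)
    (hKE : Commute K₁ E₂) (hE₁ : E₁ ^ p = 0) (hE₂ : E₂ ^ p = 0)
    (t : ℂ) :
    (t • E₁ + K₁ * E₂) ^ (p - 1) * (E₁ * K₂ + E₂) ^ (p - 1) =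
      ∑ k ∈ Finset.range p, (t ^ (p - 1 - k) * ((q ^ 2) ^ (p - 1)) ^ k) •
        (E₁ ^ (p - 1) * K₁ ^ k * (E₂ ^ (p - 1) * K₂ ^ k)) := by
  have hp := h.one_lt
  have hp1 : p - 1 + 1 = p := by omega
  rw [add_pow_of_mul_eq_smul (KE_mul_smul_E h₁ hEE t), add_pow_of_mul_eq_smul (E_mul_EK h h₂ hEE),
    hp1, Finset.sum_mul_sum, Finset.sum_comm]
  refine Finset.sum_congr rfl fun k hk => ?_
  have hk := Finset.mem_range.1 hk
  have key (l : ℕ) : (t • E₁) ^ l * (K₁ * E₂) ^ (p - 1 - l) *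
      ((E₁ * K₂) ^ k * E₂ ^ (p - 1 - k)) =
      (t ^ l * (q ^ 2) ^ ((p - 1 - l) * k + k * (p - 1 - k))) •
        (E₁ ^ (l + k) * K₁ ^ (p - 1 - l) * (E₂ ^ (p - 1 - l + (p - 1 - k)) * K₂ ^ k)) := by
    rw [smul_pow, hKE.mul_pow, hEK.mul_pow]
    have c1 : E₂ ^ (p - 1 - l) * E₁ ^ k = E₁ ^ k * E₂ ^ (p - 1 - l) :=
      (hEE.symm.pow_pow _ _).eq
    have c2 := pow_mul_pow_of_mul_eq_smul h₁ (p - 1 - l) k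
    have c3 := pow_mul_pow_of_mul_eq_smul h₂ k (p - 1 - k)
    calc _ = t ^ l • (E₁ ^ l * (K₁ ^ (p - 1 - l) * (E₂ ^ (p - 1 - l) * E₁ ^ k) *
          (K₂ ^ k * E₂ ^ (p - 1 - k)))) := by
          simp only [smul_mul_assoc, mul_assoc]
      _ = t ^ l • (E₁ ^ l * ((K₁ ^ (p - 1 - l) * E₁ ^ k) * E₂ ^ (p - 1 - l) *
          (K₂ ^ k * E₂ ^ (p - 1 - k)))) := by
          rw [c1]; simp only [mul_assoc]
      _ = _ := by
          rw [c2, c3]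
          simp only [smul_mul_assoc, mul_smul_comm, smul_smul, mul_assoc, pow_add]
          congr 1; ring
  -- Off `l + k = p - 1`, the exponent of `E₁` or that of `E₂` is at least `p`.
  have hterm (l : ℕ) (hl : l ∈ Finset.range p) (hlk : l ≠ p - 1 - k) :
      gaussBinom (q ^ 2) (p - 1) l • ((t • E₁) ^ l * (K₁ * E₂) ^ (p - 1 - l)) *
      gaussBinom (q ^ 2)⁻¹ (p - 1) k • ((E₁ * K₂) ^ k * E₂ ^ (p - 1 - k)) = 0 := by
    have hl := Finset.mem_range.1 hl
    rw [smul_mul_smul_comm, key]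
    rcases Nat.lt_or_ge (p - 1) (l + k) with hlt | hge
    · rw [pow_eq_zero_of_le (show p ≤ l + k by omega) hE₁]; simp
    · rw [pow_eq_zero_of_le (show p ≤ p - 1 - l + (p - 1 - k) by omega) hE₂]; simp
  rw [Finset.sum_eq_single_of_mem (p - 1 - k) (Finset.mem_range.2 (by omega)) hterm,
    smul_mul_smul_comm, key, smul_smul, mul_comm (gaussBinom _ _ _),
    gaussBinom_mul_gaussBinom_inv h.prim_sq (by omega), one_mul,
    show p - 1 - (p - 1 - k) = k by omega, show p - 1 - k + k = p - 1 by omega,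
    show k + (p - 1 - k) = p - 1 by omega, ← mul_add, show k + (p - 1 - k) = p - 1 by omega,
    mul_comm k, pow_mul (q ^ 2)]

end raising

/-! ### Cyclic vectors for two commuting nilpotent operators -/

/-- If `F` and `e` commute and have vanishing `p`-th powers, then the family `F ^ i e ^ j w` is
linearly independent as soon as its last member is nonzero: this member spans the socle of the
algebra `ℂ[F, e] / (F ^ p, e ^ p)`. -/
theorem linearIndependent_pow_mul_pow {M : Type*} [AddCommGroup M] [Module ℂ M] {p : ℕ}
    {F e : Module.End ℂ M} (hFe : Commute F e) (hF : F ^ p = 0) (he : e ^ p = 0) {w : M}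
    (hw : (F ^ (p - 1) * e ^ (p - 1)) w ≠ 0) :
    LinearIndependent ℂ fun ij : Fin p × Fin p => (F ^ (ij.1 : ℕ) * e ^ (ij.2 : ℕ)) w := by
  rw [Fintype.linearIndependent_iff]
  intro c hc
  suffices H : ∀ n : ℕ, ∀ ij : Fin p × Fin p, (ij.1 : ℕ) + ij.2 = n → c ij = 0 from
    fun ij => H _ ij rfl
  intro n
  induction n using Nat.strong_induction_on with
  | _ n ih =>
  rintro ⟨i, j⟩ hij
  have hmul (k l : ℕ) : (F ^ (p - 1 - i) * e ^ (p - 1 - j)) ((F ^ k * e ^ l) w) =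
      (F ^ (p - 1 - i + k) * e ^ (p - 1 - j + l)) w := by
    rw [← Module.End.mul_apply, (hFe.symm.pow_pow (p - 1 - j) k).mul_mul_mul_comm, ← pow_add,
      ← pow_add]
  -- This operator moves the `(i, j)` term to the last member of the family. It kills the terms with
  -- `k > i` or `l > j`, and the others have smaller total degree `k + l`.
  have h0 := congrArg (F ^ (p - 1 - i) * e ^ (p - 1 - j)) hc
  rw [map_sum, map_zero, Finset.sum_eq_single (i, j)] at h0
  · rw [map_smul, hmul, Nat.sub_add_cancel (by omega), Nat.sub_add_cancel (by omega)] at h0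
    exact (smul_eq_zero.1 h0).resolve_right hw
  · rintro ⟨k, l⟩ - hkl
    rw [map_smul, hmul]
    by_cases hk : (i : ℕ) < k
    · rw [pow_eq_zero_of_le (show p ≤ p - 1 - i + k by omega) hF]; simp
    by_cases hl : (j : ℕ) < l
    · rw [pow_eq_zero_of_le (show p ≤ p - 1 - j + l by omega) he]; simp
    have hne : ¬ ((k : ℕ) = i ∧ (l : ℕ) = j) := by
      rintro ⟨h1, h2⟩
      exact hkl (Prod.ext (Fin.ext h1) (Fin.ext h2))
    rw [ih (k + l) (by simp only at hij; omega) (k, l) rfl, zero_smul]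
  · simp

/-! ### The modules `V_lam` -/

section module

variable {q : ℂ} {p : ℕ}

theorem repGen_K_mul_e (h : IsOddRoot q p) (lam : ℂ) :
    repGen q p lam .K * repGen q p lam .e = q ^ 2 • (repGen q p lam .e * repGen q p lam .K) := by
  have := congrArg (rep h lam) (mul_of_conj (UqSl.Kinv_K (q := q)) UqSl.K_e)
  simpa [rep_gen] using this

/-- The powers of `e` lower the index of a normal basis vector; the scalar is nonzero if no factor
`[lam + 1 - i]_q` vanishes. -/
theorem repGen_e_pow_v {lam : ℂ} (hlam : ∀ i : ℕ, i ≤ p → qnum q (lam + 1 - i) ≠ 0) (n : ℕ)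
    (hn : n < p) (m : ℕ) (hm : m ≤ n) :
    ∃ c : ℂ, c ≠ 0 ∧ (repGen q p lam .e ^ m) (v ⟨n, hn⟩) =
      c • v ⟨n - m, (Nat.sub_le _ _).trans_lt hn⟩ := by
  induction m with
  | zero => exact ⟨1, one_ne_zero, by simp⟩
  | succ m ih =>
    obtain ⟨c, hc, hcv⟩ := ih (by omega)
    refine ⟨c * qnum q (lam + 1 - (n - m : ℕ)), mul_ne_zero hc (hlam _ (by omega)), ?_⟩
    rw [pow_succ', Module.End.mul_apply, hcv, map_smul, repGen_e_v, if_neg (by simp; omega),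
      smul_smul]
    rfl

theorem repGen_e_pow (q : ℂ) (p : ℕ) (lam : ℂ) : repGen q p lam .e ^ p = 0 := by
  have key (m : ℕ) (i : Fin p) (hi : (i : ℕ) < m) : (repGen q p lam .e ^ m) (v i) = 0 := by
    induction m generalizing i with
    | zero => omega
    | succ m ih =>
      rw [pow_succ, Module.End.mul_apply, repGen_e_v]
      split_ifs with h0
      · exact map_zero _
      · rw [map_smul, ih _ (by simp only; omega), smul_zero]
  refine (Pi.basisFun ℂ (Fin p)).ext fun i => ?_
  rw [Pi.basisFun_apply]
  exact key p i i.isLt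

theorem repGen_K_pow_v (lam : ℂ) (i : Fin p) (k : ℕ) :
    (repGen q p lam .K ^ k) (v i) = (q ^ (lam - 2 * (i : ℂ))) ^ k • v i := by
  induction k with
  | zero => simp
  | succ k ih => rw [pow_succ', Module.End.mul_apply, ih, map_smul, repGen_K_v, smul_smul, pow_succ]

theorem v_tmul_v_ne_zero (i j : Fin p) : (v i ⊗ₜ[ℂ] v j : V p ⊗[ℂ] V p) ≠ 0 := by
  simpa [v] using ((Pi.basisFun ℂ (Fin p)).tensorProduct (Pi.basisFun ℂ (Fin p))).ne_zero (i, j)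

theorem qnum_sub_one_ne_zero (h : IsOddRoot q p) : qnum q ((p : ℂ) - 1) ≠ 0 := by
  have hq := h.ne_zero
  have h1 : q ^ ((p : ℂ) - 1) = q⁻¹ := by
    rw [Complex.cpow_sub _ _ hq, Complex.cpow_natCast, h.prim.pow_eq_one, Complex.cpow_one, one_div]
  rw [qnum, Complex.cpow_neg, h1, inv_inv]
  refine div_ne_zero ?_ h.sub_inv_ne_zero
  rw [← neg_sub]
  exact neg_ne_zero.2 h.sub_inv_ne_zero

end module

/-! ### The raising operators on the tensor product -/

section tensor

variable {q : ℂ} {p : ℕ}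

/-- The homogeneous polynomial `∑ t ^ (p - 1 - k) s ^ k` is `(t ^ p - s ^ p) / (t - s)`, so it
vanishes exactly if `t / s` is a `p`-th root of unity other than `1`. -/
theorem geom_sum_ne_zero_iff {ζ : ℂ} (h : IsPrimitiveRoot ζ p) (hp : 0 < p) {s : ℂ} (hs : s ≠ 0)
    (t : ℂ) : ∑ k ∈ Finset.range p, t ^ (p - 1 - k) * s ^ k ≠ 0 ↔
      ∀ m : ℕ, 1 ≤ m → m < p → t ≠ s * ζ ^ m := by
  have hgeom : (∑ k ∈ Finset.range p, t ^ (p - 1 - k) * s ^ k) * (s - t) = s ^ p - t ^ p := by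
    rw [← (Commute.all s t).geom_sum₂_mul p]
    simp only [mul_comm]
  constructor
  · rintro hC m hm hmp rfl
    refine hC ((mul_eq_zero.1 (hgeom.trans ?_)).resolve_right ?_)
    · rw [mul_pow, ← pow_mul, mul_comm m, pow_mul, h.pow_eq_one, one_pow, mul_one, sub_self]
    · intro h0
      refine h.pow_ne_one_of_pos_of_lt (by omega) hmp (mul_left_cancel₀ hs ?_)
      rw [mul_one]
      exact (sub_eq_zero.1 h0).symm
  · intro ht hC
    rw [hC, zero_mul] at hgeom
    have : NeZero p := ⟨hp.ne'⟩
    obtain ⟨m, hm, hmt⟩ := h.eq_pow_of_pow_eq_one (ξ := t / s) (by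
      rw [div_pow, ← sub_eq_zero.1 hgeom.symm, div_self (pow_ne_zero _ hs)])
    have hts : t = s * ζ ^ m := by rw [hmt, mul_div_cancel₀ _ hs]
    rcases Nat.eq_zero_or_pos m with rfl | hm0
    · obtain rfl : t = s := by simpa using hts
      simp only [mul_comm (t ^ (p - 1 - _)), geom_sum₂_self] at hC
      exact mul_ne_zero (Nat.cast_ne_zero.2 hp.ne') (pow_ne_zero _ hs) hC
    · exact ht m hm0 hm hts

/-- `Condition2` in terms of `s = q ^ (lam₁ + lam₂ - 2 (p - 1))`: as `l` runs over `1, …, p - 1`,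
the excluded values of `y / x` are `s (q ^ 2) ^ (p - l)`. -/
theorem condition2_iff (h : IsOddRoot q p) (lam₁ lam₂ : ℂ) (x y : ℂˣ) :
    Condition2 q p lam₁ lam₂ x y ↔ ∀ m : ℕ, 1 ≤ m → m < p →
      (y : ℂ) / x ≠ q ^ (lam₁ + lam₂ - 2 * ((p : ℂ) - 1)) * (q ^ 2) ^ m := by
  have key (l m : ℕ) (hlm : l + m = p) : q ^ (lam₁ + lam₂ - 2 * ((l : ℂ) - 1)) =
      q ^ (lam₁ + lam₂ - 2 * ((p : ℂ) - 1)) * (q ^ 2) ^ m := by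
    rw [← pow_mul, ← Complex.cpow_natCast q (2 * m), ← Complex.cpow_add _ _ h.ne_zero, ← hlm]
    congr 1
    push_cast
    ring
  constructor
  · intro H m h1 h2
    rw [← key (p - m) m (by omega)]
    exact H (p - m) (by omega) (by omega)
  · intro H l h1 h2
    rw [key l (p - l) (by omega)]
    exact H (p - l) (by omega) (by omega)

theorem tensorRep_e_one_eq (h : IsOddRoot q p) (lam₁ lam₂ : ℂ) (x y : ℂˣ) :
    tensorRep h lam₁ lam₂ x y (UqAff.gen q (.e 1)) =
      TensorProduct.map (repGen q p lam₁ .e) 1 * TensorProduct.map 1 (repGen q p lam₂ .K) +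
        TensorProduct.map 1 (repGen q p lam₂ .e) := by
  refine TensorProduct.ext' fun a b => ?_
  simp [tensorRep_e_one]

theorem tensorRep_f_zero_eq (h : IsOddRoot q p) (lam₁ lam₂ : ℂ) (x y : ℂˣ) :
    tensorRep h lam₁ lam₂ x y (UqAff.gen q (.f 0)) = (q * (y : ℂ)⁻¹) •
      (((y : ℂ) / x) • TensorProduct.map (repGen q p lam₁ .e) 1 +
        TensorProduct.map (repGen q p lam₁ .K) 1 * TensorProduct.map 1 (repGen q p lam₂ .e)) := by
  refine TensorProduct.ext' fun a b => ?_
  have hy : (y : ℂ) ≠ 0 := y.ne_zero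
  have hc : q * (y : ℂ)⁻¹ * ((y : ℂ) / x) = q * (x : ℂ)⁻¹ := by field_simp
  simp [tensorRep_f_zero, smul_smul, hc]

theorem commute_map_one_one_map {M N : Type*} [AddCommGroup M] [Module ℂ M] [AddCommGroup N]
    [Module ℂ N] (f : Module.End ℂ M) (g : Module.End ℂ N) :
    Commute (TensorProduct.map f (1 : Module.End ℂ N)) (TensorProduct.map (1 : Module.End ℂ M) g) :=
  TensorProduct.ext' fun a b => by simp

theorem map_one_pow {M N : Type*} [AddCommGroup M] [Module ℂ M] [AddCommGroup N] [Module ℂ N]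
    (f : Module.End ℂ M) (n : ℕ) :
    (TensorProduct.map f (1 : Module.End ℂ N)) ^ n = TensorProduct.map (f ^ n) 1 := by
  simp

theorem one_map_pow {M N : Type*} [AddCommGroup M] [Module ℂ M] [AddCommGroup N] [Module ℂ N]
    (f : Module.End ℂ N) (n : ℕ) :
    (TensorProduct.map (1 : Module.End ℂ M) f) ^ n = TensorProduct.map 1 (f ^ n) := by
  simp

theorem map_K_mul_map_e_left (h : IsOddRoot q p) (lam : ℂ) :
    (TensorProduct.map (repGen q p lam .K) 1 * TensorProduct.map (repGen q p lam .e) 1 :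
      Module.End ℂ (V p ⊗[ℂ] V p)) =
      q ^ 2 • (TensorProduct.map (repGen q p lam .e) 1 * TensorProduct.map (repGen q p lam .K) 1) := by
  rw [← TensorProduct.map_mul, ← TensorProduct.map_mul, repGen_K_mul_e h,
    TensorProduct.map_smul_left]

theorem map_K_mul_map_e_right (h : IsOddRoot q p) (lam : ℂ) :
    (TensorProduct.map 1 (repGen q p lam .K) * TensorProduct.map 1 (repGen q p lam .e) :
      Module.End ℂ (V p ⊗[ℂ] V p)) =
      q ^ 2 • (TensorProduct.map 1 (repGen q p lam .e) * TensorProduct.map 1 (repGen q p lam .K)) := by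
  rw [← TensorProduct.map_mul, ← TensorProduct.map_mul, repGen_K_mul_e h,
    TensorProduct.map_smul_right]

theorem map_e_left_pow (q : ℂ) (p : ℕ) (lam : ℂ) :
    (TensorProduct.map (repGen q p lam .e) 1 : Module.End ℂ (V p ⊗[ℂ] V p)) ^ p = 0 := by
  rw [map_one_pow, repGen_e_pow, TensorProduct.map_zero_left]

theorem map_e_right_pow (q : ℂ) (p : ℕ) (lam : ℂ) :
    (TensorProduct.map 1 (repGen q p lam .e) : Module.End ℂ (V p ⊗[ℂ] V p)) ^ p = 0 := by
  rw [one_map_pow, repGen_e_pow, TensorProduct.map_zero_right]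

theorem tensorRep_e_one_pow (h : IsOddRoot q p) (lam₁ lam₂ : ℂ) (x y : ℂˣ) :
    tensorRep h lam₁ lam₂ x y (UqAff.gen q (.e 1)) ^ p = 0 := by
  rw [tensorRep_e_one_eq]
  exact EK_add_E_pow (A := Module.End ℂ (V p ⊗[ℂ] V p)) h (map_K_mul_map_e_right h lam₂)
    (commute_map_one_one_map _ _) (commute_map_one_one_map _ _) (map_e_left_pow q p lam₁)
    (map_e_right_pow q p lam₂)

theorem tensorRep_f_zero_pow (h : IsOddRoot q p) (lam₁ lam₂ : ℂ) (x y : ℂˣ) :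
    tensorRep h lam₁ lam₂ x y (UqAff.gen q (.f 0)) ^ p = 0 := by
  rw [tensorRep_f_zero_eq, smul_pow,
    E_add_KE_pow (A := Module.End ℂ (V p ⊗[ℂ] V p)) h (map_K_mul_map_e_left h lam₁)
      (commute_map_one_one_map _ _) (commute_map_one_one_map _ _) (map_e_left_pow q p lam₁)
      (map_e_right_pow q p lam₂), smul_zero]

/-- The last member of the family is a nonzero multiple of `v₀ ⊗ w₀`, times the homogeneous
polynomial of degree `p - 1` in `y / x` and `s = q ^ (lam₁ + lam₂ - 2 (p - 1))` whose coefficients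
are all `1`. -/
theorem exists_tensorRep_pow_lowestVector (h : IsOddRoot q p) {lam₁ lam₂ : ℂ} (x y : ℂˣ)
    (h₁ : ∀ i : ℕ, i ≤ p → qnum q (lam₁ + 1 - i) ≠ 0)
    (h₂ : ∀ i : ℕ, i ≤ p → qnum q (lam₂ + 1 - i) ≠ 0) :
    ∃ (c : ℂ) (i : Fin p), c ≠ 0 ∧
      (tensorRep h lam₁ lam₂ x y (UqAff.gen q (.f 0)) ^ (p - 1) *
        tensorRep h lam₁ lam₂ x y (UqAff.gen q (.e 1)) ^ (p - 1)) (lowestVector h) =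
      (c * ∑ k ∈ Finset.range p, ((y : ℂ) / x) ^ (p - 1 - k) *
        (q ^ (lam₁ + lam₂ - 2 * ((p : ℂ) - 1))) ^ k) • (v i ⊗ₜ[ℂ] v i) := by
  have hp := h.one_lt
  have hq := h.ne_zero
  have hlt : p - 1 < p := by omega
  obtain ⟨c₁, hc₁, hv₁⟩ := repGen_e_pow_v h₁ (p - 1) hlt (p - 1) le_rfl
  obtain ⟨c₂, hc₂, hv₂⟩ := repGen_e_pow_v h₂ (p - 1) hlt (p - 1) le_rfl
  refine ⟨(q * (y : ℂ)⁻¹) ^ (p - 1) * qnum q ((p : ℂ) - 1) * (c₁ * c₂),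
    ⟨p - 1 - (p - 1), by omega⟩, ?_, ?_⟩
  · exact mul_ne_zero (mul_ne_zero (pow_ne_zero _ (mul_ne_zero hq (inv_ne_zero y.ne_zero)))
      (qnum_sub_one_ne_zero h)) (mul_ne_zero hc₁ hc₂)
  have hs : (q ^ 2) ^ (p - 1) * (q ^ (lam₁ - 2 * ((p - 1 : ℕ) : ℂ)) *
      q ^ (lam₂ - 2 * ((p - 1 : ℕ) : ℂ))) = q ^ (lam₁ + lam₂ - 2 * ((p : ℂ) - 1)) := by
    rw [← pow_mul, ← Complex.cpow_natCast q (2 * (p - 1)), ← Complex.cpow_add _ _ hq,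
      ← Complex.cpow_add _ _ hq]
    congr 1
    push_cast [Nat.cast_sub hp.le]
    ring
  have hk (k : ℕ) : (TensorProduct.map (repGen q p lam₁ .e) 1 ^ (p - 1) *
      TensorProduct.map (repGen q p lam₁ .K) 1 ^ k *
      (TensorProduct.map 1 (repGen q p lam₂ .e) ^ (p - 1) *
        TensorProduct.map 1 (repGen q p lam₂ .K) ^ k) : Module.End ℂ (V p ⊗[ℂ] V p))
      (v ⟨p - 1, hlt⟩ ⊗ₜ[ℂ] v ⟨p - 1, hlt⟩) =
      ((q ^ (lam₁ - 2 * ((p - 1 : ℕ) : ℂ)) * q ^ (lam₂ - 2 * ((p - 1 : ℕ) : ℂ))) ^ k *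
        (c₁ * c₂)) •
      (v ⟨p - 1 - (p - 1), by omega⟩ ⊗ₜ[ℂ] v ⟨p - 1 - (p - 1), by omega⟩) := by
    simp only [map_one_pow, one_map_pow, Module.End.mul_apply, TensorProduct.map_tmul,
      Module.End.one_apply, repGen_K_pow_v, map_smul, hv₁, hv₂, ← TensorProduct.smul_tmul',
      TensorProduct.tmul_smul, smul_smul]
    congr 1
    ring
  rw [tensorRep_f_zero_eq, tensorRep_e_one_eq, smul_pow, smul_mul_assoc,
    raising_pow_mul_raising_pow (A := Module.End ℂ (V p ⊗[ℂ] V p)) h (map_K_mul_map_e_left h lam₁)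
      (map_K_mul_map_e_right h lam₂) (commute_map_one_one_map _ _) (commute_map_one_one_map _ _)
      (commute_map_one_one_map _ _) (map_e_left_pow q p lam₁) (map_e_right_pow q p lam₂),
    lowestVector, map_smul, LinearMap.smul_apply, LinearMap.sum_apply]
  simp only [LinearMap.smul_apply, hk, smul_smul]
  rw [← Finset.sum_smul, smul_smul, Finset.mul_sum, Finset.mul_sum]
  congr 1
  refine Finset.sum_congr rfl fun k _ => ?_
  rw [← hs, mul_pow]
  ring

end tensor

end QAffine

open QAffine in
theorem theorem5p2 (p : ℕ) (q : ℂ) (h : IsOddRoot q p) (lam₁ lam₂ : ℂ) (x y : ℂˣ)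
    (h₁ : Condition1 q p lam₁ lam₂) :
    (∃ b : Module.Basis (Fin p × Fin p) ℂ (V p ⊗[ℂ] V p), ∀ i j : Fin p,
        b (i, j) = tensorRep h lam₁ lam₂ x y
          (UqAff.gen q (.f 0) ^ (i : ℕ) * UqAff.gen q (.e 1) ^ (j : ℕ)) (lowestVector h)) ↔
      Condition2 q p lam₁ lam₂ x y := by
  have hp : 0 < p := zero_lt_one.trans h.one_lt
  have hlt : p - 1 < p := Nat.sub_lt hp one_pos
  obtain ⟨c, i₀, hc, htop⟩ := exists_tensorRep_pow_lowestVector h x y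
    (fun i hi => (h₁.1 i hi).1) (fun i hi => (h₁.1 i hi).2)
  have hcomm : Commute (tensorRep h lam₁ lam₂ x y (UqAff.gen q (.f 0)))
      (tensorRep h lam₁ lam₂ x y (UqAff.gen q (.e 1))) :=
    (Commute.map (sub_eq_zero.1 (UqAff.e_f' 1 0 (by decide))) _).symm
  rw [condition2_iff h, ← geom_sum_ne_zero_iff h.prim_sq hp
    (by simp [Complex.cpow_eq_zero_iff, h.ne_zero])]
  simp only [map_mul, map_pow]
  constructor
  · rintro ⟨b, hb⟩ hsum
    refine b.ne_zero (⟨p - 1, hlt⟩, ⟨p - 1, hlt⟩) ((hb _ _).trans (htop.trans ?_))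
    rw [hsum, mul_zero, zero_smul]
  · intro hsum
    have : Nonempty (Fin p × Fin p) := ⟨(i₀, i₀)⟩
    have hli := linearIndependent_pow_mul_pow hcomm (tensorRep_f_zero_pow h lam₁ lam₂ x y)
      (tensorRep_e_one_pow h lam₁ lam₂ x y) (w := lowestVector h)
      (htop ▸ smul_ne_zero (mul_ne_zero hc hsum) (v_tmul_v_ne_zero i₀ i₀))
    exact ⟨basisOfLinearIndependentOfCardEqFinrank hli (by simp), fun i j => by simp⟩
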